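/- Let $n,k\ge 0$ and let $T=T^{n+k}=(S^1)^{n+k}$. The $k$-standard action of $T$ on $\mathbb C^n\times T^k\subset\mathbb C^{n+k}$ is coordinatewise multiplication. Let $M$ be a locally $k$-standard $T$-manifold, i.e. a smooth manifold of dimension $2n+k$ with an effective continuous $T$-action such that every point of $M$ has a $T$-invariant open neighbourhood $U$ which, for some automorphism $\theta$ of the topological group $T$, is $\theta$-equivariantly diffeomorphic to an invariant open subset of $\mathbb C^n\times T^k$. The orbit space $M/T$ is then a manifold with corners, locally modelled on $(\mathbb C^n\times T^k)/T=\mathbb R^n_{\ge 0}$. Let $P$ be an $n$-dimensional simple polytope (the convex hull of finitely many points, each vertex lying in exactly $n$ facets), and suppose that $M/T$ is identified with $P$ as a manifold with corners, i.e. by a homeomorphism such that an orbit on which exactly $d$ of the $\mathbb C^n$-coordinates vanish in a local model corresponds to a point lying in exactly $d$ facets of $P$. Let $\mathfrak q\colon M\to P$ be the resulting orbit map and $\mathcal F(P)$ the set of facets of $P$. For $v\in\mathbb Z^{n+k}$ let $S^1(v)=\{(z^{v_1},\dots,z^{v_{n+k}}) : z\in S^1\}\subseteq T$. Then there is a function $\lambda\colon\mathcal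 F(P)\to\mathbb Z^{n+k}$ such that, for every facet $F$, the vector $\lambda(F)$ is primitive and the subgroup of $T$ fixing $\mathfrak q^{-1}(F)$ pointwise is $S^1(\lambda(F))$. Moreover, for every such function $\lambda$ (an axiomatic characteristic function of $M$): 1. $\lambda$ is a hyper characteristic function: if $F_{1},\dots,F_{n}$ are distinct facets with $F_{1}\cap\dots\cap F_{n}\ne\emptyset$, then $\lambda(F_{1}),\dots,\lambda(F_{n})$ are part of a $\mathbb Z$-basis of $\mathbb Z^{n+k}$; 2. $M$ is $T$-equivariantly homeomorphic to $M(P,\lambda)=(T\times P)/{\sim}$, where $(t,p)\sim(s,q)$ if and only if $p=q$ and $t^{-1}s\in T_p$, with $T_p$ the subgroup of $T$ generated by the circles $S^1(\lambda(F))$ for the facets $F$ containing $p$, and where $T$ acts on $M(P,\lambda)$ by multiplication on the first factor. -/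

import Mathlib

open scoped Manifold ContDiff

noncomputable section

/-! ### Tori and circle subgroups -/

/-- The compact torus `T^m = (S¹)^m`, with pointwise multiplication and the product topology. -/
abbrev Torus (m : ℕ) : Type := Fin m → Circle

/-- The homomorphism `S¹ → T^m`, `z ↦ (z^{v₁}, …, z^{v_m})`, given by an integer vector `v`. -/
def circleHom {m : ℕ} (v : Fin m → ℤ) : Circle →* Torus m where
  toFun z := fun i => z ^ v i
  map_one' := by funext i; simp
  map_mul' z w := by funext i; simp [mul_zpow]

/-- The subgroup of `T^m` determined by the integer vector `v`. -/
def circleSubgroup {m : ℕ} (v : Fin m → ℤ) : Subgroup (Torus m) := (circleHom v).range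

/-- An integer vector is primitive if the greatest common divisor of its entries is `1`. -/
def IsPrimitiveVector {m : ℕ} (v : Fin m → ℤ) : Prop := Finset.univ.gcd v = 1

/-! ### The local model and locally `k`-standard manifolds -/

/-- The space `ℂ^n × T^k`. -/
abbrev LocalModel (n k : ℕ) : Type := (Fin n → ℂ) × (Fin k → Circle)

/-- The model with corners (without boundary) of the product manifold `ℂ^n × T^k`. -/
abbrev localModelCorners (n k : ℕ) :=
  (𝓘(ℝ, Fin n → ℂ)).prod (ModelWithCorners.pi (fun _ : Fin k => 𝓡 1))

/-- The `k`-standard action of `T^{n+k}` on `ℂ^n × T^k` by coordinatewise multiplication. -/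
def kStandardAct {n k : ℕ} (t : Torus (n + k)) (x : LocalModel n k) : LocalModel n k :=
  (fun i => (t (Fin.castAdd k i) : ℂ) * x.1 i, fun j => t (Fin.natAdd n j) * x.2 j)

section LocallyStandard

variable (n k : ℕ) (M : Type*) [TopologicalSpace M]
  [ChartedSpace (EuclideanSpace ℝ (Fin (2 * n + k))) M] [MulAction (Torus (n + k)) M]

/-- A `k`-standard chart: an automorphism `θ` of the topological group `T^{n+k}` and a
diffeomorphism of a `T^{n+k}`-invariant open set `U ⊆ M` with an open set `V ⊆ ℂ^n × T^k` which is
`θ`-equivariant. (The set `V` is then invariant too, because `θ` is surjective.) -/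
structure KStandardChart where
  θ : Torus (n + k) ≃ₜ* Torus (n + k)
  toHomeo : OpenPartialHomeomorph M (LocalModel n k)
  smul_mem_source : ∀ (t : Torus (n + k)), ∀ x ∈ toHomeo.source, t • x ∈ toHomeo.source
  map_smul : ∀ (t : Torus (n + k)), ∀ x ∈ toHomeo.source,
    toHomeo (t • x) = kStandardAct (θ t) (toHomeo x)
  contMDiffOn : ContMDiffOn (𝓡 (2 * n + k)) (localModelCorners n k) ∞ toHomeo toHomeo.source
  contMDiffOn_symm :
    ContMDiffOn (localModelCorners n k) (𝓡 (2 * n + k)) ∞ toHomeo.symm toHomeo.target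

/-- `M` is a locally `k`-standard `T`-manifold: the action of `T^{n+k}` is effective and every point
lies in the domain of a `k`-standard chart. (The charts force the action to be smooth.) -/
structure IsLocallyKStandard : Prop where
  effective : FaithfulSMul (Torus (n + k)) M
  exists_chart : ∀ p : M, ∃ c : KStandardChart n k M, p ∈ c.toHomeo.source

end LocallyStandard

/-! ### Simple polytopes -/

section Polytope

variable {E : Type*} [NormedAddCommGroup E] [NormedSpace ℝ E]

/-- A facet of a convex set `P`: a nonempty (exposed) face of codimension one. -/
structure IsFacet (P F : Set E) : Prop where
  isExposed : IsExposed ℝ P F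
  nonempty : F.Nonempty
  codim_one : Module.finrank ℝ (vectorSpan ℝ F) + 1 = Module.finrank ℝ (vectorSpan ℝ P)

/-- The set `𝓕(P)` of facets of `P`, as a type. -/
abbrev Facets (P : Set E) : Type _ := {F : Set E // IsFacet P F}

/-- The number of facets of `P` which contain `x`. -/
def facetCount (P : Set E) (x : E) : ℕ := {F : Facets P | x ∈ F.1}.ncard

/-- `P` is a simple polytope of dimension `n`: a nonempty convex hull of finitely many points, whose
affine hull has dimension `n`, and each of whose vertices lies in exactly `n` facets. -/
structure IsSimplePolytope (n : ℕ) (P : Set E) : Prop where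
  exists_finite : ∃ s : Set E, s.Finite ∧ P = convexHull ℝ s
  nonempty : P.Nonempty
  dim_eq : Module.finrank ℝ (vectorSpan ℝ P) = n
  simple : ∀ v ∈ P.extremePoints ℝ, facetCount P v = n

/-! ### Hyper characteristic functions and the quotient construction -/

/-- `ξ : 𝓕(P) → ℤ^{n+k}` is a (generalized) hyper characteristic function: whenever `n` distinct
facets have a common point, their values under `ξ` are part of a `ℤ`-basis of `ℤ^{n+k}`. -/
def IsHyperCharacteristic (n k : ℕ) (P : Set E) (ξ : Facets P → Fin (n + k) → ℤ) : Prop :=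
  ∀ f : Fin n → Facets P, Function.Injective f → (⋂ i, (f i).1).Nonempty →
    ∃ b : Module.Basis (Fin (n + k)) ℤ (Fin (n + k) → ℤ), ∀ i, b (Fin.castAdd k i) = ξ (f i)

variable {m : ℕ}

/-- The subgroup `T_x` of `T^m` determined by the vectors `ξ(F)`, where `F` runs through the facets
containing `x`, that is, through the facets whose intersection is the face with `x` in its relative
interior. It is trivial if `x` lies in no facet. -/
def isotropySubgroup (P : Set E) (ξ : Facets P → Fin m → ℤ) (x : E) : Subgroup (Torus m) :=
  ⨆ F : {F : Facets P // x ∈ F.1}, circleSubgroup (ξ F.1)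

/-- The relation `(t, p) ∼ (s, q)` iff `p = q` and `t⁻¹ s ∈ T_p`, on `T^m × P`. -/
def quotientSetoid (P : Set E) (ξ : Facets P → Fin m → ℤ) : Setoid (Torus m × P) where
  r a b := a.2 = b.2 ∧ a.1⁻¹ * b.1 ∈ isotropySubgroup P ξ a.2
  iseqv :=
    { refl := fun a => ⟨rfl, by simp [one_mem]⟩
      symm := by
        rintro ⟨t, p⟩ ⟨s, q⟩ ⟨h, h'⟩
        obtain rfl : p = q := h
        refine ⟨rfl, ?_⟩
        have := inv_mem h'
        simpa using this
      trans := by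
        rintro ⟨t, p⟩ ⟨s, q⟩ ⟨r, u⟩ ⟨h, h'⟩ ⟨g, g'⟩
        obtain rfl : p = q := h
        obtain rfl : p = u := g
        refine ⟨rfl, ?_⟩
        have := mul_mem h' g'
        simpa [mul_assoc] using this }

/-- The identification space `M(P, ξ) = (T^m × P)/∼`. -/
def QuotientConstruction (P : Set E) (ξ : Facets P → Fin m → ℤ) : Type _ :=
  Quotient (quotientSetoid P ξ)

/-- The quotient topology. -/
instance (P : Set E) (ξ : Facets P → Fin m → ℤ) : TopologicalSpace (QuotientConstruction P ξ) :=
  inferInstanceAs (TopologicalSpace (Quotient (quotientSetoid P ξ)))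

/-- The action of `T^m` induced by multiplication on the first factor, `t • [s, p] = [t * s, p]`. -/
instance (P : Set E) (ξ : Facets P → Fin m → ℤ) :
    MulAction (Torus m) (QuotientConstruction P ξ) where
  smul t := Quotient.map (fun a => (t * a.1, a.2)) (by
    rintro ⟨s, p⟩ ⟨r, q⟩ ⟨h, h'⟩
    refine ⟨h, ?_⟩
    simpa [mul_assoc] using h')
  one_smul := by
    rintro ⟨a⟩
    exact congrArg (Quotient.mk _) (Prod.ext (one_mul _) rfl)
  mul_smul t s := by
    rintro ⟨a⟩
    exact congrArg (Quotient.mk _) (Prod.ext (mul_assoc _ _ _) rfl)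

end Polytope

/-! ### Orbit space and axiomatic characteristic function -/

section OrbitSpace

variable {n k : ℕ} {M : Type*} [TopologicalSpace M]
  [ChartedSpace (EuclideanSpace ℝ (Fin (2 * n + k))) M] [MulAction (Torus (n + k)) M]
  {E : Type*} [NormedAddCommGroup E] [NormedSpace ℝ E] {P : Set E}

/-- The orbit space `M / T^{n+k}`, with the quotient topology. -/
abbrev OrbitSpace (n k : ℕ) (M : Type*) [MulAction (Torus (n + k)) M] : Type _ :=
  MulAction.orbitRel.Quotient (Torus (n + k)) M

/-- The orbit map `𝔮 : M → P` obtained from an identification of `M / T^{n+k}` with `P`. -/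
def orbitMap (Φ : OrbitSpace n k M ≃ₜ P) (x : M) : P := Φ (Quotient.mk _ x)

/-- The homeomorphism `M / T^{n+k} ≃ P` is one of manifolds with corners, that is, it preserves the
codimension of faces. A `k`-standard chart identifies the orbit space locally with
`(ℂ^n × T^k) / T^{n+k} = ℝ^n_{≥ 0}`, by `(z, w) ↦ (|z₁|, …, |z_n|)`; so an orbit lies in the relative
interior of a face of codimension `d` of the orbit space iff exactly `d` of the complex coordinates
of its points vanish. A point of the simple polytope `P` lies in the relative interior of a face of
codimension `d` iff it is contained in exactly `d` facets. -/
def PreservesCorners (Φ : OrbitSpace n k M ≃ₜ P) : Prop :=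
  ∀ c : KStandardChart n k M, ∀ x ∈ c.toHomeo.source,
    {i : Fin n | (c.toHomeo x).1 i = 0}.ncard = facetCount P (orbitMap Φ x : E)

/-- `lam : 𝓕(P) → ℤ^{n+k}` is an axiomatic characteristic function of `M` (over the orbit space `P`):
for each facet `F`, the isotropy subgroup of `𝔮⁻¹(F)`, i.e. the subgroup which fixes `𝔮⁻¹(F)`
pointwise, is the circle subgroup determined by the primitive vector `lam F`. This determines
`lam F` up to sign. -/
def IsAxiomaticCharacteristic (Φ : OrbitSpace n k M ≃ₜ P) (lam : Facets P → Fin (n + k) → ℤ) :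
    Prop :=
  ∀ F : Facets P, IsPrimitiveVector (lam F) ∧
    fixingSubgroup (Torus (n + k)) {x : M | (orbitMap Φ x : E) ∈ F.1} = circleSubgroup (lam F)

end OrbitSpace

end

/-! In a chart the stabilizer of a point is the product of the coordinate circles of its vanishing
complex coordinates. Continuous characters of the circle are powers, so automorphisms of the torus
act on `ℤ^{n+k}` invertibly, and these circles come from part of a basis. What remains is to match
vanishing coordinates with facets and to glue the local pictures.

Matching: making all but one vanishing coordinate nonzero moves `x` to nearby points over the
relative interior of a single facet. That interior is convex and stabilizers are locally constant
over it, so each facet carries one circle. Distinct basis vectors give distinct circles, so distinct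
coordinates yield distinct facets; `PreservesCorners` equates the numbers, and the matching is
bijective (`exists_equiv_facets`). A primitive vector is determined by its circle up to sign, which
gives the hyper characteristic condition.

Gluing: it suffices to find a global section `s` of the orbit map, since `(t, p) ↦ t • s p` then
induces a continuous equivariant bijection from a compact space to a Hausdorff one. Contract `P`
along segments from a point `c` in no facet. Stabilizers are trivial along such a segment until its
endpoint, so they only increase with time. Under this condition homotopies lift
(`exists_homotopy_lift`): where `g = t • a` is continuous and `b` has larger stabilizers than `a`,
`t • b` is continuous even if `t` is not (`ContinuousAt.transport`). Lifting the contraction from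
the constant map at time `0` gives the section at time `1`. -/

/-! ### Homomorphisms between tori -/

section Torus

open MeasureTheory AddCircle

/-- The Haar integral of a nontrivial continuous character of the circle vanishes. -/
theorem integral_character_eq_zero (g : UnitAddCircle → ℂ)
    (hg : ∀ x y, g (x + y) = g x * g y) {a : UnitAddCircle} (ha : g a ≠ 1) :
    ∫ x, g x ∂haarAddCircle = 0 := by
  have h1 : ∫ x, g (a + x) ∂haarAddCircle = ∫ x, g x ∂haarAddCircle :=
    integral_add_left_eq_self g a
  simp only [hg, integral_const_mul] at h1
  have h2 : (g a - 1) * ∫ x, g x ∂haarAddCircle = 0 := by rw [sub_mul, h1, one_mul, sub_self]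
  exact (mul_eq_zero.1 h2).resolve_left (sub_ne_zero.2 ha)

/-- Every continuous endomorphism of the circle is a power map. -/
theorem Circle.exists_eq_zpow (f : Circle →* Circle) (hf : Continuous f) :
    ∃ n : ℤ, ∀ z, f z = z ^ n := by
  let F : C(UnitAddCircle, ℂ) :=
    ⟨fun x => (f (toCircle x) : ℂ),
      continuous_subtype_val.comp (hf.comp AddCircle.continuous_toCircle)⟩
  have hF : ∀ x y, F (x + y) = F x * F y := by
    intro x y
    simp [F, toCircle_add]
  -- If `f` is no power map, each Fourier coefficient of `F` integrates a nontrivial character and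
  -- vanishes. The Fourier series then sums to `F` pointwise, so `F 0 = 0`, whereas `F 0 = 1`.
  by_contra hne
  push Not at hne
  have hcoef : ∀ n, fourierCoeff F n = 0 := by
    intro n
    obtain ⟨z, hz⟩ := hne n
    obtain ⟨a, rfl⟩ : ∃ a : UnitAddCircle, toCircle a = z :=
      ⟨(AddCircle.homeomorphCircle one_ne_zero).symm z, by
        rw [← AddCircle.homeomorphCircle_apply one_ne_zero, Homeomorph.apply_symm_apply]⟩
    refine integral_character_eq_zero (fun x => fourier (-n) x • F x) ?_ (a := a) ?_
    · intro x y
      simp only [hF, smul_eq_mul, fourier_apply, smul_add, toCircle_add, Circle.coe_mul]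
      ring
    · intro h
      apply hz
      simp only [smul_eq_mul, fourier_apply, neg_smul, toCircle_neg, toCircle_zsmul] at h
      have h' : (toCircle a ^ n)⁻¹ * f (toCircle a) = 1 := by
        ext
        simpa [F] using h
      exact (inv_mul_eq_one.1 h').symm
  have hsum : Summable (fourierCoeff F) := by
    rw [show fourierCoeff F = fun _ => 0 from funext hcoef]
    exact summable_zero
  have h0 := has_pointwise_sum_fourier_series_of_summable hsum 0
  simp only [hcoef, zero_smul] at h0
  have := h0.unique hasSum_zero
  simp [F] at this

variable {m : ℕ}

@[simp]
theorem circleHom_apply (v : Fin m → ℤ) (z : Circle) (i : Fin m) : circleHom v z i = z ^ v i := rfl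

/-- A continuous homomorphism from the circle to a torus is given by an integer vector. -/
theorem exists_eq_circleHom (f : Circle →* Torus m) (hf : Continuous f) :
    ∃ v, f = circleHom v := by
  have h : ∀ i, ∃ n : ℤ, ∀ z, f z i = z ^ n := fun i =>
    Circle.exists_eq_zpow ((Pi.evalMonoidHom _ i).comp f) ((continuous_apply i).comp hf)
  choose v hv using h
  exact ⟨v, MonoidHom.ext fun z => funext fun i => hv i z⟩

theorem Circle.exists_zpow_injective :
    ∃ z : Circle, Function.Injective fun n : ℤ => z ^ n := by
  -- Finite order would mean `n = 2πj` with nonzero integers `n`, `j`, making `π` rational.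
  refine ⟨Circle.exp 1, ?_⟩
  rw [injective_zpow_iff_not_isOfFinOrder, isOfFinOrder_iff_pow_eq_one]
  rintro ⟨n, hn, h⟩
  rw [← Circle.exp_nsmul, Circle.exp_eq_one] at h
  obtain ⟨j, hj⟩ := h
  have hn' : (n : ℝ) ≠ 0 := by positivity
  have hj' : (j : ℝ) ≠ 0 := by
    rintro h0
    simp [h0] at hj
    omega
  apply irrational_pi
  refine ⟨n / (2 * j), ?_⟩
  push_cast
  simp at hj
  field_simp
  linarith

theorem circleHom_injective : Function.Injective (circleHom : (Fin m → ℤ) → _) := by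
  intro v w h
  obtain ⟨z, hz⟩ := Circle.exists_zpow_injective
  funext i
  exact hz (congrFun (DFunLike.congr_fun h z) i)

theorem circleHom_eq_prod (v : Fin m → ℤ) (z : Circle) :
    circleHom v z = ∏ i, Pi.mulSingle i (z ^ v i) :=
  (Finset.univ_prod_mulSingle (circleHom v z)).symm

theorem Circle.zpow_sum (z : Circle) (f : Fin m → ℤ) : z ^ (∑ i, f i) = ∏ i, z ^ f i := by
  have h := map_prod (zpowersHom Circle z) (fun i => Multiplicative.ofAdd (f i)) Finset.univ
  rw [← ofAdd_sum] at h
  simpa only [zpowersHom_apply, toAdd_ofAdd] using h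

theorem circleHom_linearCombination (w : Fin m → Fin m → ℤ) (u : Fin m → ℤ) (z : Circle) :
    circleHom (Fintype.linearCombination ℤ w u) z = ∏ i, circleHom (w i) (z ^ u i) := by
  funext j
  simp only [circleHom_apply, Finset.prod_apply, Fintype.linearCombination_apply, Finset.sum_apply,
    Pi.smul_apply, smul_eq_mul, ← zpow_mul]
  exact Circle.zpow_sum z _

/-- A continuous endomorphism of a torus acts on integer vectors by a linear map. -/
theorem exists_linearMap_circleHom (θ : Torus m →* Torus m) (hθ : Continuous θ) :
    ∃ A : (Fin m → ℤ) →ₗ[ℤ] (Fin m → ℤ), ∀ u z, θ (circleHom u z) = circleHom (A u) z := by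
  have h : ∀ i, ∃ v, θ.comp (MonoidHom.mulSingle (fun _ : Fin m => Circle) i) = circleHom v :=
    fun i => exists_eq_circleHom _ (hθ.comp (continuous_mulSingle (A := fun _ : Fin m => Circle) i))
  choose w hw using h
  refine ⟨Fintype.linearCombination ℤ w, fun u z => ?_⟩
  rw [circleHom_linearCombination, circleHom_eq_prod, map_prod]
  exact Finset.prod_congr rfl fun i _ => DFunLike.congr_fun (hw i) _

theorem circleHom_single (i : Fin m) (z : Circle) :
    circleHom (Pi.single i 1) z = Pi.mulSingle i z := by
  funext j
  by_cases h : j = i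
  · subst h; simp
  · simp [h]

/-- An automorphism of a torus sends the coordinate circles to circles given by a basis. -/
theorem exists_basis_circleHom (θ : Torus m ≃ₜ* Torus m) :
    ∃ b : Module.Basis (Fin m) ℤ (Fin m → ℤ), ∀ i z,
      θ (Pi.mulSingle i z) = circleHom (b i) z := by
  obtain ⟨A, hA⟩ := exists_linearMap_circleHom θ.toMulEquiv.toMonoidHom θ.continuous
  obtain ⟨B, hB⟩ := exists_linearMap_circleHom θ.symm.toMulEquiv.toMonoidHom θ.symm.continuous
  have hA' : ∀ u z, θ (circleHom u z) = circleHom (A u) z := hA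
  have hB' : ∀ u z, θ.symm (circleHom u z) = circleHom (B u) z := hB
  have hAB : ∀ u, A (B u) = u := fun u => circleHom_injective <| MonoidHom.ext fun z => by
    rw [← hA', ← hB']; simp
  have hBA : ∀ u, B (A u) = u := fun u => circleHom_injective <| MonoidHom.ext fun z => by
    rw [← hB', ← hA']; simp
  refine ⟨(Pi.basisFun ℤ (Fin m)).map
    (LinearEquiv.ofLinearMap A B (LinearMap.ext hAB) (LinearMap.ext hBA)), fun i z => ?_⟩
  rw [← circleHom_single, hA']
  simp

theorem isPrimitiveVector_basis (b : Module.Basis (Fin m) ℤ (Fin m → ℤ)) (i : Fin m) :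
    IsPrimitiveVector (b i) := by
  have h : ∀ j, ∃ c, b i j = Finset.univ.gcd (b i) * c := fun j =>
    Finset.gcd_dvd (Finset.mem_univ j)
  choose u hu using h
  have h1 : b i = Finset.univ.gcd (b i) • u := funext fun j => by simpa using hu j
  -- The `i`-th coordinate of `b i` is `1`, so the gcd divides `1`.
  have h2 := congrArg (b.coord i) h1
  rw [map_smul] at h2
  have h3 : IsUnit (Finset.univ.gcd (b i)) := IsUnit.of_mul_eq_one (b.coord i u) (by
    simpa using h2.symm)
  rw [IsPrimitiveVector, ← Finset.normalize_gcd, normalize_eq_one]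
  exact h3

/-- A primitive vector is determined up to sign by its circle subgroup. -/
theorem eq_or_eq_neg_of_circleSubgroup_le {v w : Fin m → ℤ} (hv : IsPrimitiveVector v)
    (hw : IsPrimitiveVector w) (h : circleSubgroup v ≤ circleSubgroup w) : v = w ∨ v = -w := by
  -- Bézout coefficients for `w` recover `y` from the powers `y ^ w i = z ^ v i`, so `y = z ^ d` for
  -- some `d`. As `z` has infinite order, `v = d • w`, and primitivity of `v` forces `d = ±1`.
  obtain ⟨a, ha⟩ := Finset.univ.gcd_eq_sum_mul w
  rw [show Finset.univ.gcd w = 1 from hw] at ha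
  obtain ⟨z, hz⟩ := Circle.exists_zpow_injective
  obtain ⟨y, hy⟩ := h ⟨z, rfl⟩
  have hy' : ∀ i, y ^ w i = z ^ v i := fun i => congrFun hy i
  have hyz : y = z ^ (∑ i, v i * a i) := by
    calc y = y ^ (∑ i, w i * a i) := by rw [← ha, zpow_one]
      _ = ∏ i, y ^ (w i * a i) := Circle.zpow_sum y _
      _ = ∏ i, z ^ (v i * a i) := by simp only [zpow_mul, hy']
      _ = z ^ (∑ i, v i * a i) := (Circle.zpow_sum z _).symm
  generalize (∑ i, v i * a i) = d at hyz
  have hvd : ∀ i, v i = d * w i := fun i => hz (by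
    change z ^ v i = z ^ (d * w i)
    rw [zpow_mul, ← hyz, hy'])
  have hd : d ∣ 1 := by
    rw [← show Finset.univ.gcd v = 1 from hv]
    exact Finset.dvd_gcd fun i _ => ⟨_, hvd i⟩
  rcases Int.isUnit_iff.1 (isUnit_of_dvd_one hd) with rfl | rfl
  · exact Or.inl (funext fun i => by simp [hvd i])
  · exact Or.inr (funext fun i => by simp [hvd i])

end Torus

/-! ### Lifting homotopies along orbit maps of compact groups -/

section HomotopyLifting

open Topology Filter

variable {G M : Type*} [Group G] [TopologicalSpace G] [CompactSpace G] [TopologicalSpace M]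
  [T2Space M] [MulAction G M] [ContinuousSMul G M]

/-- If `t • a` is continuous at a point at which the stabilizer of `a` is contained in that of `b`,
then `t • b` is continuous there, although `t` need not be continuous. -/
theorem ContinuousAt.transport {X : Type*} [TopologicalSpace X] {a b : X → M} {t : X → G} {x₀ : X}
    (ha : ContinuousAt a x₀) (hb : ContinuousAt b x₀)
    (hg : ContinuousAt (fun x => t x • a x) x₀)
    (hstab : MulAction.stabilizer G (a x₀) ≤ MulAction.stabilizer G (b x₀)) :
    ContinuousAt (fun x => t x • b x) x₀ := by
  refine tendsto_iff_ultrafilter _ _ _ |>.2 fun u hu => ?_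
  -- By compactness `t` has a limit `s` along each ultrafilter. It differs from `t x₀` by an element
  -- fixing `a x₀`, hence fixing `b x₀`, so the limit of `t • b` does not depend on the ultrafilter.
  obtain ⟨s, -, hs⟩ := isCompact_univ.ultrafilter_le_nhds (u.map t) (by simp)
  have ht : Tendsto t u (𝓝 s) := hs
  have h1 : s • a x₀ = t x₀ • a x₀ :=
    tendsto_nhds_unique (ht.smul (ha.mono_left hu)) (hg.mono_left hu)
  have h2 : (t x₀)⁻¹ * s ∈ MulAction.stabilizer G (a x₀) := by
    rw [MulAction.mem_stabilizer_iff, mul_smul, h1, inv_smul_smul]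
  have h3 : s • b x₀ = t x₀ • b x₀ := by
    have := hstab h2
    rwa [MulAction.mem_stabilizer_iff, mul_smul, inv_smul_eq_iff] at this
  have h4 := ht.smul (hb.mono_left hu)
  rwa [h3] at h4

variable {B X : Type*} [TopologicalSpace B] {q : M → B}

/-- A lift of `x ↦ H x (τ x)` is transported along a local section to a lift of
`x ↦ H x (τ' x)`, where `τ'` differs from `τ` only inside a small set. -/
theorem exists_lift_of_local_section [TopologicalSpace X]
    (hinv : ∀ (t : G) x, q (t • x) = q x) (hq : ∀ x y, q x = q y → ∃ t : G, t • x = y)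
    {H : X → ℝ → B} (hH : Continuous fun p : X × ℝ => H p.1 p.2)
    (hstab : ∀ x s s', s ≤ s' → ∀ y y', q y = H x s → q y' = H x s' →
      MulAction.stabilizer G y ≤ MulAction.stabilizer G y')
    {τ τ' : X → ℝ} (hτ : Continuous τ) (hτ' : Continuous τ') (hle : ∀ x, τ x ≤ τ' x)
    {K W : Set X} (hK : IsClosed K) (hW : IsOpen W) (hKW : K ⊆ W) (heq : ∀ x ∉ K, τ' x = τ x)
    {U : Set B} (hU : IsOpen U) {s : B → M} (hs : ContinuousOn s U) (hqs : ∀ p ∈ U, q (s p) = p)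
    (hWU : ∀ x ∈ W, H x (τ x) ∈ U) (hWU' : ∀ x ∈ W, H x (τ' x) ∈ U)
    {g : X → M} (hg : Continuous g) (hqg : ∀ x, q (g x) = H x (τ x)) :
    ∃ g' : X → M, Continuous g' ∧ ∀ x, q (g' x) = H x (τ' x) := by
  classical
  have ht : ∀ x, ∃ t : G, x ∈ W → t • s (H x (τ x)) = g x := by
    intro x
    by_cases hx : x ∈ W
    · obtain ⟨t, ht⟩ := hq (s (H x (τ x))) (g x) (by rw [hqs _ (hWU x hx), hqg])
      exact ⟨t, fun _ => ht⟩
    · exact ⟨1, fun h => absurd h hx⟩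
  choose t ht using ht
  -- On `W \ K` the times `τ` and `τ'` agree, so the first formula returns `g` there and the two
  -- pieces glue.
  refine ⟨fun x => if x ∈ W then t x • s (H x (τ' x)) else g x, ?_, fun x => ?_⟩
  · refine continuous_iff_continuousAt.2 fun x => ?_
    by_cases hx : x ∈ W
    · have hWx : W ∈ 𝓝 x := hW.mem_nhds hx
      have ha : ContinuousAt (fun x => s (H x (τ x))) x :=
        ContinuousAt.comp (f := fun x => H x (τ x)) (hs.continuousAt (hU.mem_nhds (hWU x hx)))
          (hH.comp (continuous_id.prodMk hτ)).continuousAt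
      have hb : ContinuousAt (fun x => s (H x (τ' x))) x :=
        ContinuousAt.comp (f := fun x => H x (τ' x)) (hs.continuousAt (hU.mem_nhds (hWU' x hx)))
          (hH.comp (continuous_id.prodMk hτ')).continuousAt
      have hta : ContinuousAt (fun x => t x • s (H x (τ x))) x :=
        hg.continuousAt.congr (by filter_upwards [hWx] with y hy using (ht y hy).symm)
      refine (ha.transport hb hta (hstab x _ _ (hle x) _ _ (hqs _ (hWU x hx))
        (hqs _ (hWU' x hx)))).congr ?_
      filter_upwards [hWx] with y hy
      simp [hy]
    · refine hg.continuousAt.congr ?_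
      filter_upwards [hK.isOpen_compl.mem_nhds fun h => hx (hKW h)] with y hy
      by_cases hyW : y ∈ W
      · simp [hyW, heq y hy, ht y hyW]
      · simp [hyW]
  · by_cases hx : x ∈ W
    · simp [hx, hinv, hqs _ (hWU' x hx)]
    · simp [hx, hqg, heq x fun h => hx (hKW h)]

/-- Lifting over a slab `X × [a, b]` which is small compared to a cover by sets with sections. -/
theorem exists_lift_slab [PseudoMetricSpace X] [CompactSpace X]
    (hinv : ∀ (t : G) x, q (t • x) = q x) (hq : ∀ x y, q x = q y → ∃ t : G, t • x = y)
    {H : X → ℝ → B} (hH : Continuous fun p : X × ℝ => H p.1 p.2)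
    (hstab : ∀ x s s', s ≤ s' → ∀ y y', q y = H x s → q y' = H x s' →
      MulAction.stabilizer G y ≤ MulAction.stabilizer G y')
    {a b δ : ℝ} (hδ : 0 < δ) (hab : a ≤ b) (hba : b < a + δ)
    (hsec : ∀ x, ∃ U : Set B, IsOpen U ∧ (∃ s : B → M, ContinuousOn s U ∧ ∀ p ∈ U, q (s p) = p) ∧
      ∀ y c, dist y x < δ → dist c a < δ → H y c ∈ U)
    {g : X → M} (hg : Continuous g) (hqg : ∀ x, q (g x) = H x a) :
    ∃ g' : X → M, Continuous g' ∧ ∀ x, q (g' x) = H x b := by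
  -- The time front `τ` is raised from `a` to `b` over one small ball after another.
  have key : ∀ S : Finset X, ∃ (τ : X → ℝ) (g' : X → M), Continuous τ ∧ (∀ x, a ≤ τ x ∧ τ x ≤ b) ∧
      (∀ y ∈ S, ∀ x, dist x y ≤ δ / 3 → τ x = b) ∧ Continuous g' ∧ ∀ x, q (g' x) = H x (τ x) := by
    intro S
    induction S using Finset.cons_induction with
    | empty => exact ⟨fun _ => a, g, continuous_const, fun _ => ⟨le_rfl, hab⟩, by simp, hg, hqg⟩
    | cons y S hy ih =>
      obtain ⟨τ, g₁, hτ, hτab, hτS, hg₁, hqg₁⟩ := ih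
      obtain ⟨U, hU, ⟨s, hs, hqs⟩, hHU⟩ := hsec y
      -- A bump equal to `1` within distance `δ / 3` of `y` and to `0` beyond `2δ / 3`.
      let φ : X → ℝ := fun x => max 0 (min 1 (2 - dist x y / (δ / 3)))
      have hφ : Continuous φ := by fun_prop
      have hφ0 : ∀ x, 0 ≤ φ x := fun x => le_max_left _ _
      have hφ1 : ∀ x, φ x ≤ 1 := fun x => max_le zero_le_one (min_le_left _ _)
      let τ' : X → ℝ := fun x => max (τ x) (a + (b - a) * φ x)
      have hτ' : Continuous τ' := by fun_prop
      have hτ'ab : ∀ x, a ≤ τ' x ∧ τ' x ≤ b := fun x =>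
        ⟨(hτab x).1.trans (le_max_left _ _), max_le (hτab x).2 (by
          nlinarith [hφ1 x, mul_le_mul_of_nonneg_left (hφ1 x) (sub_nonneg.2 hab)])⟩
      have hdist : ∀ c, a ≤ c ∧ c ≤ b → dist c a < δ := by
        rintro c ⟨h1, h2⟩
        rw [Real.dist_eq, abs_of_nonneg (by linarith)]
        linarith
      obtain ⟨g₂, hg₂, hqg₂⟩ := exists_lift_of_local_section hinv hq hH hstab hτ hτ'
        (fun x => le_max_left _ _) (K := Metric.closedBall y (δ / 3 * 2)) (W := Metric.ball y δ)
        Metric.isClosed_closedBall Metric.isOpen_ball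
        (Metric.closedBall_subset_ball (by linarith))
        (fun x hx => by
          have hx' : 2 ≤ dist x y / (δ / 3) := by
            rw [le_div_iff₀ (by positivity)]
            have : ¬ dist x y ≤ δ / 3 * 2 := hx
            linarith
          have : φ x = 0 := max_eq_left ((min_le_right _ _).trans (by linarith))
          simp [τ', this, (hτab x).1])
        hU hs hqs (fun x hx => hHU x _ hx (hdist _ (hτab x)))
        (fun x hx => hHU x _ hx (hdist _ (hτ'ab x))) hg₁ hqg₁
      refine ⟨τ', g₂, hτ', hτ'ab, ?_, hg₂, hqg₂⟩
      intro z hz x hx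
      rcases Finset.mem_cons.1 hz with rfl | hz
      · have hx' : dist x z / (δ / 3) ≤ 1 := (div_le_one (by positivity)).2 hx
        have : φ x = 1 := by
          have : min 1 (2 - dist x z / (δ / 3)) = 1 := min_eq_left (by linarith)
          simp [φ, this]
        simp [τ', this, (hτab x).2]
      · have := hτS z hz x hx
        exact le_antisymm (hτ'ab x).2 (this.symm.le.trans (le_max_left _ _))
  obtain ⟨t, -, ht, hcov⟩ := finite_cover_balls_of_compact (isCompact_univ (X := X))
    (show 0 < δ / 3 by positivity)
  obtain ⟨τ, g', -, -, hτ, hg', hqg'⟩ := key ht.toFinset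
  refine ⟨g', hg', fun x => ?_⟩
  obtain ⟨y, hy, hxy⟩ := Set.mem_iUnion₂.1 (hcov (Set.mem_univ x))
  rw [hqg', hτ y (ht.mem_toFinset.2 hy) x (Metric.mem_ball.1 hxy).le]

/-- Homotopy lifting for the orbit map of an action of a compact group with local sections, along
homotopies on whose tracks the stabilizers increase. -/
theorem exists_homotopy_lift [PseudoMetricSpace X] [CompactSpace X]
    (hinv : ∀ (t : G) x, q (t • x) = q x) (hq : ∀ x y, q x = q y → ∃ t : G, t • x = y)
    (hsec : ∀ p, ∃ U : Set B, IsOpen U ∧ p ∈ U ∧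
      ∃ s : B → M, ContinuousOn s U ∧ ∀ p ∈ U, q (s p) = p)
    {H : X → ℝ → B} (hH : Continuous fun p : X × ℝ => H p.1 p.2)
    (hstab : ∀ x s s', s ≤ s' → ∀ y y', q y = H x s → q y' = H x s' →
      MulAction.stabilizer G y ≤ MulAction.stabilizer G y')
    {g : X → M} (hg : Continuous g) (hqg : ∀ x, q (g x) = H x 0) :
    ∃ g' : X → M, Continuous g' ∧ ∀ x, q (g' x) = H x 1 := by
  choose U hU hpU hs using hsec
  obtain ⟨δ, hδ, hball⟩ := lebesgue_number_lemma_of_metric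
    (s := (Set.univ : Set X) ×ˢ Set.Icc (0 : ℝ) 1) (c := fun p => (fun z : X × ℝ => H z.1 z.2) ⁻¹' U p)
    (isCompact_univ.prod isCompact_Icc) (fun p => (hU p).preimage hH)
    (fun z _ => Set.mem_iUnion.2 ⟨H z.1 z.2, hpU _⟩)
  -- Slabs of height `1 / (N + 1)` are thinner than the Lebesgue number `δ`.
  obtain ⟨N, hN⟩ := exists_nat_one_div_lt hδ
  have hN0 : (0 : ℝ) < N + 1 := by positivity
  have key : ∀ i : ℕ, i ≤ N + 1 → ∃ g' : X → M, Continuous g' ∧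
      ∀ x, q (g' x) = H x (i / (N + 1)) := by
    intro i
    induction i with
    | zero => exact fun _ => ⟨g, hg, by simpa using hqg⟩
    | succ i ih =>
      intro hi
      obtain ⟨g₁, hg₁, hqg₁⟩ := ih (by omega)
      have hstep : ((i + 1 : ℕ) : ℝ) / (N + 1) = i / (N + 1) + 1 / (N + 1) := by
        push_cast; ring
      refine exists_lift_slab hinv hq hH hstab hδ ?_ ?_ (fun x => ?_) hg₁ hqg₁
      · rw [hstep]
        have : (0 : ℝ) < 1 / (N + 1) := by positivity
        linarith
      · rw [hstep]
        linarith
      · obtain ⟨p, hp⟩ := hball (x, (i : ℝ) / (N + 1)) ⟨Set.mem_univ _, by positivity, by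
          rw [div_le_one hN0]
          exact_mod_cast (by omega : i ≤ N + 1)⟩
        refine ⟨U p, hU p, hs p, fun y c hy hc => ?_⟩
        exact hp (show (y, c) ∈ Metric.ball (x, (i : ℝ) / (N + 1)) δ from
          max_lt hy hc)
  obtain ⟨g', hg', hqg'⟩ := key (N + 1) le_rfl
  refine ⟨g', hg', fun x => ?_⟩
  rw [hqg']
  congr 1
  push_cast
  exact div_self hN0.ne'

end HomotopyLifting

/-! ### Facets of polytopes -/

section PolytopeFacets

variable {E : Type*} [NormedAddCommGroup E] [NormedSpace ℝ E] {P : Set E} {n : ℕ}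

theorem IsSimplePolytope.isCompact (hP : IsSimplePolytope n P) : IsCompact P := by
  obtain ⟨s, hs, rfl⟩ := hP.exists_finite
  exact hs.isCompact_convexHull ℝ

theorem IsSimplePolytope.convex (hP : IsSimplePolytope n P) : Convex ℝ P := by
  obtain ⟨s, -, rfl⟩ := hP.exists_finite
  exact convex_convexHull ℝ s

/-- By Krein–Milman a facet is recovered from its extreme points, which belong to the finite set
spanning `P`. -/
theorem IsSimplePolytope.finite_facets (hP : IsSimplePolytope n P) : Finite (Facets P) := by
  obtain ⟨s, hs, hPs⟩ := hP.exists_finite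
  have hsub : ∀ F : Facets P, F.1.extremePoints ℝ ⊆ s := fun F =>
    F.2.isExposed.isExtreme.extremePoints_subset_extremePoints.trans
      (hPs ▸ extremePoints_convexHull_subset)
  have := hs.finite_subsets.to_subtype
  refine Finite.of_injective (fun F => (⟨_, hsub F⟩ : {t : Set E | t ⊆ s})) fun F F' h => ?_
  have h' : F.1.extremePoints ℝ = F'.1.extremePoints ℝ := congrArg Subtype.val h
  have hKM : ∀ F : Facets P, closure (convexHull ℝ (F.1.extremePoints ℝ)) = F.1 := fun F =>
    closure_convexHull_extremePoints (F.2.isExposed.isCompact hP.isCompact)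
      (F.2.isExposed.convex hP.convex)
  exact Subtype.ext (by rw [← hKM F, h', hKM])

/-- The points of `P` which lie in the facet `F` and in no other facet. -/
def openFacet (F : Facets P) : Set P := {p | ∀ F' : Facets P, (p : E) ∈ F'.1 ↔ F' = F}

/-- Removing an extreme subset from `P` leaves a convex set, so an open facet is an intersection of
convex sets. -/
theorem isPreconnected_openFacet (hP : Convex ℝ P) (F : Facets P) :
    IsPreconnected (openFacet F) := by
  rw [← Topology.IsInducing.subtypeVal.isPreconnected_image]
  have h : (Subtype.val '' openFacet F : Set E) =
      F.1 ∩ ⋂ F' : {F' : Facets P // F' ≠ F}, P \ F'.1.1 := by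
    ext x
    simp only [openFacet, Set.mem_image, Set.mem_ofPred_eq, Set.mem_inter_iff, Set.mem_iInter,
      Set.mem_sdiff, Subtype.forall (p := fun F' : Facets P => F' ≠ F)]
    constructor
    · rintro ⟨p, hp, rfl⟩
      exact ⟨(hp F).2 rfl, fun F' hF' => ⟨p.2, fun h => hF' ((hp F').1 h)⟩⟩
    · rintro ⟨hx, hx'⟩
      refine ⟨⟨x, F.2.isExposed.subset hx⟩, fun F' => ⟨fun h => ?_, ?_⟩, rfl⟩
      · by_contra hne
        exact (hx' F' hne).2 h
      · rintro rfl
        exact hx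
  rw [h]
  exact ((F.2.isExposed.convex hP).inter
    (convex_iInter fun F' => F'.1.2.isExposed.isExtreme.convex_sdiff hP)).isPreconnected

theorem facetCount_eq_one_iff {p : P} : facetCount P (p : E) = 1 ↔ ∃ F, p ∈ openFacet F := by
  rw [facetCount, Set.ncard_eq_one]
  exact exists_congr fun F => Set.ext_iff

theorem facetCount_eq_zero_iff [Finite (Facets P)] {x : E} :
    facetCount P x = 0 ↔ ∀ F : Facets P, x ∉ F.1 := by
  rw [facetCount, Set.ncard_eq_zero, Set.eq_empty_iff_forall_notMem]
  rfl

/-- The half-open segment from a point in no facet to another point of `P` meets no facet. -/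
theorem lineMap_notMem_facet {c p : E} (hc : c ∈ P) (hp : p ∈ P)
    (hcF : ∀ F : Facets P, c ∉ F.1) {s : ℝ} (h0 : 0 ≤ s) (h1 : s < 1) (F : Facets P) :
    AffineMap.lineMap c p s ∉ F.1 := by
  intro h
  rcases h0.eq_or_lt with rfl | h0
  · rw [AffineMap.lineMap_apply_zero] at h
    exact hcF F h
  · refine hcF F (F.2.isExposed.isExtreme.left_mem_of_mem_openSegment hc hp h ?_)
    rw [openSegment_eq_image_lineMap]
    exact ⟨s, ⟨h0, h1⟩, rfl⟩

end PolytopeFacets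

/-! ### `k`-standard charts -/

namespace KStandardChart

open Topology Filter

variable {n k : ℕ} {M : Type*} [TopologicalSpace M]
  [ChartedSpace (EuclideanSpace ℝ (Fin (2 * n + k))) M] [MulAction (Torus (n + k)) M]
  (c : KStandardChart n k M)

/-- The indices of the complex coordinates which vanish at `x`. -/
def zeros (x : M) : Set (Fin n) := {i | (c.toHomeo x).1 i = 0}

/-- The basis of `ℤ^{n+k}` that corresponds to the coordinate circles of a chart. -/
noncomputable def basis : Module.Basis (Fin (n + k)) ℤ (Fin (n + k) → ℤ) :=
  (exists_basis_circleHom c.θ.symm).choose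

theorem θ_symm_mulSingle (i : Fin (n + k)) (z : Circle) :
    c.θ.symm (Pi.mulSingle i z) = circleHom (c.basis i) z :=
  (exists_basis_circleHom c.θ.symm).choose_spec i z

theorem θ_circleHom (i : Fin (n + k)) (z : Circle) :
    c.θ (circleHom (c.basis i) z) = Pi.mulSingle i z := by
  rw [← θ_symm_mulSingle]
  exact c.θ.apply_symm_apply _

theorem mem_stabilizer_iff {x : M} (hx : x ∈ c.toHomeo.source) (t : Torus (n + k)) :
    t ∈ MulAction.stabilizer (Torus (n + k)) x ↔
      (∀ i ∉ c.zeros x, c.θ t (Fin.castAdd k i) = 1) ∧ ∀ j, c.θ t (Fin.natAdd n j) = 1 := by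
  rw [MulAction.mem_stabilizer_iff, ← c.toHomeo.injOn.eq_iff (c.smul_mem_source t x hx) hx,
    c.map_smul t x hx]
  simp only [kStandardAct, Prod.ext_iff, funext_iff, zeros, Set.mem_ofPred_eq]
  refine and_congr (forall_congr' fun i => ?_) (forall_congr' fun j => ?_)
  · by_cases h : (c.toHomeo x).1 i = 0
    · simp [h]
    · simp [h, Circle.ext_iff]
  · simp

/-- The stabilizer of a point is generated by the coordinate circles of the vanishing coordinates. -/
theorem stabilizer_eq {x : M} (hx : x ∈ c.toHomeo.source) :
    MulAction.stabilizer (Torus (n + k)) x =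
      ⨆ i : c.zeros x, circleSubgroup (c.basis (Fin.castAdd k i)) := by
  apply le_antisymm
  · intro t ht
    obtain ⟨h1, h2⟩ := (c.mem_stabilizer_iff hx t).1 ht
    have key : c.θ t ∈ (⨆ i : c.zeros x, circleSubgroup (c.basis (Fin.castAdd k i))).map
        c.θ.toMulEquiv.toMonoidHom := by
      refine Subgroup.pi_mem_of_mulSingle_mem _ fun i => ?_
      induction i using Fin.addCases with
      | left i =>
        by_cases hi : i ∈ c.zeros x
        · refine ⟨circleHom (c.basis (Fin.castAdd k i)) (c.θ t (Fin.castAdd k i)), ?_,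
            c.θ_circleHom _ _⟩
          exact Subgroup.mem_iSup_of_mem (⟨i, hi⟩ : c.zeros x) ⟨_, rfl⟩
        · rw [h1 i hi, Pi.mulSingle_one]
          exact one_mem _
      | right j =>
        rw [h2 j, Pi.mulSingle_one]
        exact one_mem _
    obtain ⟨s, hs, hst⟩ := key
    rwa [← c.θ.injective hst]
  · refine iSup_le fun i => ?_
    rintro _ ⟨z, rfl⟩
    rw [c.mem_stabilizer_iff hx]
    have h : c.θ (circleHom (c.basis (Fin.castAdd k i)) z) = _ := c.θ_circleHom _ z
    rw [h]
    refine ⟨fun j hj => Pi.mulSingle_eq_of_ne ?_ _, fun j => Pi.mulSingle_eq_of_ne ?_ _⟩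
    · rintro h
      exact hj (Fin.castAdd_injective n k h ▸ i.2)
    · intro h
      have h' := congrArg Fin.val h
      have := i.1.2
      simp at h'
      omega

/-- Every set of vanishing coordinates at `x` is the set of vanishing coordinates at points which
are arbitrarily close to `x`. -/
theorem exists_perturbation {x : M} (hx : x ∈ c.toHomeo.source) {J : Set (Fin n)}
    (hJ : J ⊆ c.zeros x) :
    ∃ᶠ y in 𝓝 x, y ∈ c.toHomeo.source ∧ c.zeros y = J := by
  classical
  -- For `ε ≠ 0` this frees exactly the vanishing coordinates outside `J` and leaves all others
  -- unchanged.
  let f : ℝ → LocalModel n k := fun ε =>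
    (fun i => (c.toHomeo x).1 i + if i ∈ c.zeros x \ J then (ε : ℂ) else 0, (c.toHomeo x).2)
  have hf : Continuous f := by
    refine Continuous.prodMk (continuous_pi fun i => ?_) continuous_const
    split_ifs <;> fun_prop
  have hf0 : f 0 = c.toHomeo x := by simp [f]
  have hft : Tendsto f (𝓝[≠] 0) (𝓝 (c.toHomeo x)) := by
    rw [← hf0]
    exact hf.continuousAt.mono_left nhdsWithin_le_nhds
  have hlim : Tendsto (fun ε => c.toHomeo.symm (f ε)) (𝓝[≠] 0) (𝓝 x) :=
    (c.toHomeo.tendsto_symm hx).comp hft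
  refine hlim.frequently (Eventually.frequently ?_)
  filter_upwards [hft (c.toHomeo.open_target.mem_nhds (c.toHomeo.map_source hx)),
    self_mem_nhdsWithin] with ε hε hε0
  refine ⟨c.toHomeo.map_target hε, ?_⟩
  ext i
  have hε0' : (ε : ℂ) ≠ 0 := Complex.ofReal_ne_zero.2 hε0
  rw [zeros, Set.mem_ofPred_eq, c.toHomeo.right_inv hε]
  by_cases hi : i ∈ c.zeros x
  · have hi' : (c.toHomeo x).1 i = 0 := hi
    by_cases hiJ : i ∈ J
    · simp [f, hi', hiJ]
    · simp [f, hi, hi', hiJ, hε0']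
  · have hi' : (c.toHomeo x).1 i ≠ 0 := hi
    have hiJ : i ∉ J := fun h => hi (hJ h)
    simp [f, hi, hi', hiJ]

/-- Close to `x`, only coordinates that vanish at `x` can vanish. -/
theorem eventually_zeros_subset {x : M} (hx : x ∈ c.toHomeo.source) :
    ∀ᶠ y in 𝓝 x, y ∈ c.toHomeo.source ∧ c.zeros y ⊆ c.zeros x := by
  refine (c.toHomeo.open_source.eventually_mem hx).and ?_
  have h : ∀ i : Fin n, i ∉ c.zeros x → ∀ᶠ y in 𝓝 x, i ∉ c.zeros y := by
    intro i hi
    have hc : ContinuousAt (fun y => (c.toHomeo y).1 i) x :=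
      ((continuous_apply i).comp continuous_fst).continuousAt.comp (c.toHomeo.continuousAt hx)
    exact hc.eventually_ne hi
  have h' : ∀ᶠ y in 𝓝 x, ∀ i, i ∉ c.zeros x → i ∉ c.zeros y :=
    eventually_all.2 fun i => by
      by_cases hi : i ∈ c.zeros x
      · exact Eventually.of_forall fun y h => absurd hi h
      · exact (h i hi).mono fun y hy _ => hy
  filter_upwards [h'] with y hy i hi
  by_contra hne
  exact hy i hne hi

/-- The point in the orbit of `x` all of whose coordinates in the chart are nonnegative reals. -/
noncomputable def normalForm (x : M) : M :=
  c.toHomeo.symm (fun i => ((‖(c.toHomeo x).1 i‖ : ℝ) : ℂ), fun _ => 1)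

theorem exists_smul_eq {x : M} (hx : x ∈ c.toHomeo.source) :
    ∃ t : Torus (n + k), c.toHomeo (t • x) =
      (fun i => ((‖(c.toHomeo x).1 i‖ : ℝ) : ℂ), fun _ => 1) := by
  let s : Torus (n + k) :=
    Fin.append (fun i => (Circle.exp ((c.toHomeo x).1 i).arg)⁻¹) (fun j => ((c.toHomeo x).2 j)⁻¹)
  refine ⟨c.θ.symm s, ?_⟩
  have hs : c.θ (c.θ.symm s) = s := c.θ.apply_symm_apply s
  rw [c.map_smul _ x hx, hs]
  refine Prod.ext (funext fun i => ?_) (funext fun j => ?_)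
  · simp only [kStandardAct, s, Fin.append_left]
    conv_lhs => rw [← Complex.norm_mul_exp_arg_mul_I ((c.toHomeo x).1 i)]
    rw [Circle.coe_inv, Circle.coe_exp]
    rw [mul_left_comm]
    simp
  · simp [kStandardAct, s]

theorem normalForm_mem_orbit {x : M} (hx : x ∈ c.toHomeo.source) :
    ∃ t : Torus (n + k), t • x = c.normalForm x := by
  obtain ⟨t, ht⟩ := c.exists_smul_eq hx
  refine ⟨t, ?_⟩
  rw [normalForm, ← ht, c.toHomeo.left_inv (c.smul_mem_source t x hx)]

theorem normalForm_smul {x : M} (hx : x ∈ c.toHomeo.source) (t : Torus (n + k)) :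
    c.normalForm (t • x) = c.normalForm x := by
  simp only [normalForm, c.map_smul t x hx, kStandardAct, norm_mul, Circle.norm_coe, one_mul]

theorem continuousAt_normalForm {x : M} (hx : x ∈ c.toHomeo.source) :
    ContinuousAt c.normalForm x := by
  obtain ⟨t, ht⟩ := c.exists_smul_eq hx
  have hmem := c.toHomeo.map_source (c.smul_mem_source t x hx)
  rw [ht] at hmem
  have hf : Continuous fun y : LocalModel n k =>
      ((fun i => ((‖y.1 i‖ : ℝ) : ℂ), fun _ => 1) : LocalModel n k) := by fun_prop
  exact ContinuousAt.comp
    (f := fun x => ((fun i => ((‖(c.toHomeo x).1 i‖ : ℝ) : ℂ), fun _ => 1) : LocalModel n k))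
    (c.toHomeo.continuousAt_symm hmem)
    (hf.continuousAt.comp (c.toHomeo.continuousAt hx))

end KStandardChart

/-! ### Orbit maps -/

section OrbitMap

open Topology Filter

set_option linter.unusedSectionVars false

variable {n k : ℕ} {M : Type*} [TopologicalSpace M]
  [ChartedSpace (EuclideanSpace ℝ (Fin (2 * n + k))) M] [MulAction (Torus (n + k)) M]
  {E : Type*} [NormedAddCommGroup E] [NormedSpace ℝ E] {P : Set E}
  (Φ : OrbitSpace n k M ≃ₜ P)

theorem orbitMap_eq_iff (x y : M) :
    orbitMap Φ x = orbitMap Φ y ↔ ∃ t : Torus (n + k), t • x = y := by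
  rw [orbitMap, orbitMap, Φ.injective.eq_iff, eq_comm, Quotient.eq]
  exact Iff.rfl

theorem orbitMap_smul (t : Torus (n + k)) (x : M) : orbitMap Φ (t • x) = orbitMap Φ x :=
  ((orbitMap_eq_iff Φ _ _).2 ⟨t, rfl⟩).symm

theorem orbitMap_surjective : Function.Surjective (orbitMap Φ) :=
  Φ.surjective.comp Quotient.mk_surjective

theorem stabilizer_eq_of_orbitMap_eq {x y : M} (h : orbitMap Φ x = orbitMap Φ y) :
    MulAction.stabilizer (Torus (n + k)) x = MulAction.stabilizer (Torus (n + k)) y := by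
  obtain ⟨t, rfl⟩ := (orbitMap_eq_iff Φ x y).1 h
  ext s
  rw [MulAction.mem_stabilizer_iff, MulAction.mem_stabilizer_iff, smul_comm, smul_left_cancel_iff]

variable [ContinuousSMul (Torus (n + k)) M]

theorem continuous_orbitMap : Continuous (orbitMap Φ) :=
  Φ.continuous.comp continuous_quot_mk

theorem isOpenMap_orbitMap : IsOpenMap (orbitMap Φ) :=
  Φ.isOpenMap.comp isOpenMap_quotient_mk'_mul

/-- The orbit map has a continuous section over the image of a `k`-standard chart. -/
theorem KStandardChart.exists_local_section (c : KStandardChart n k M) :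
    ∃ s : P → M, ContinuousOn s (orbitMap Φ '' c.toHomeo.source) ∧
      ∀ p ∈ orbitMap Φ '' c.toHomeo.source, orbitMap Φ (s p) = p := by
  classical
  -- The representatives need not vary continuously: `normalForm` depends only on the orbit.
  have hr : ∀ p : P, ∃ x : M,
      p ∈ orbitMap Φ '' c.toHomeo.source → x ∈ c.toHomeo.source ∧ orbitMap Φ x = p := by
    intro p
    by_cases hp : p ∈ orbitMap Φ '' c.toHomeo.source
    · exact hp.imp fun x hx _ => hx
    · exact ⟨(orbitMap_surjective Φ p).choose, fun h => absurd h hp⟩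
  choose r hr using hr
  have hs : ∀ x ∈ c.toHomeo.source, c.normalForm (r (orbitMap Φ x)) = c.normalForm x := by
    intro x hx
    obtain ⟨h1, h2⟩ := hr _ ⟨x, hx, rfl⟩
    obtain ⟨t, ht⟩ := (orbitMap_eq_iff Φ _ _).1 h2
    rw [← c.normalForm_smul h1 t, ht]
  refine ⟨fun p => c.normalForm (r p), ?_, ?_⟩
  · rintro _ ⟨x, hx, rfl⟩
    refine ContinuousAt.continuousWithinAt ?_
    rw [ContinuousAt, hs x hx]
    -- Since the orbit map is open, continuity on `P` can be tested after pulling back to `M`.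
    refine Tendsto.mono_left ?_ ((isOpenMap_orbitMap Φ).nhds_le x)
    rw [tendsto_map'_iff]
    refine Tendsto.congr' ?_ (c.continuousAt_normalForm hx)
    filter_upwards [c.toHomeo.open_source.mem_nhds hx] with y hy using (hs y hy).symm
  · intro p hp
    obtain ⟨h1, h2⟩ := hr p hp
    obtain ⟨t, ht⟩ := c.normalForm_mem_orbit h1
    change orbitMap Φ (c.normalForm (r p)) = p
    rw [← ht, orbitMap_smul, h2]

variable {Φ}

theorem PreservesCorners.ncard_zeros (hΦ : PreservesCorners Φ) (c : KStandardChart n k M) {x : M}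
    (hx : x ∈ c.toHomeo.source) : (c.zeros x).ncard = facetCount P (orbitMap Φ x : E) :=
  hΦ c x hx

/-- The stabilizers over an open facet are all equal. -/
theorem stabilizer_eq_of_mem_openFacet (hM : IsLocallyKStandard n k M) (hP : Convex ℝ P)
    (hΦ : PreservesCorners Φ) {F : Facets P} {x y : M} (hx : orbitMap Φ x ∈ openFacet F)
    (hy : orbitMap Φ y ∈ openFacet F) :
    MulAction.stabilizer (Torus (n + k)) x = MulAction.stabilizer (Torus (n + k)) y := by
  have key := (isPreconnected_openFacet hP F).induction₂' (fun p p' => ∀ x y : M,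
    orbitMap Φ x = p → orbitMap Φ y = p' →
      MulAction.stabilizer (Torus (n + k)) x = MulAction.stabilizer (Torus (n + k)) y) ?_ ?_ hx hy
  · exact key x y rfl rfl
  · intro p hp
    suffices h : ∀ᶠ p' in 𝓝[openFacet F] p, ∀ x y : M, orbitMap Φ x = p → orbitMap Φ y = p' →
        MulAction.stabilizer (Torus (n + k)) x = MulAction.stabilizer (Torus (n + k)) y from
      h.mono fun p' h' => ⟨h', fun x y hx hy => (h' y x hy hx).symm⟩
    obtain ⟨z, rfl⟩ := orbitMap_surjective Φ p
    obtain ⟨c, hc⟩ := hM.exists_chart z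
    -- Near `z` the set of vanishing coordinates can only shrink; over the open facet it always has
    -- one element, so it is constant.
    have h1 := (isOpenMap_orbitMap Φ).image_mem_nhds (c.eventually_zeros_subset hc)
    filter_upwards [mem_nhdsWithin_of_mem_nhds h1, self_mem_nhdsWithin]
    rintro _ ⟨w, ⟨hw, hwz⟩, rfl⟩ hwF x y hx hy
    rw [stabilizer_eq_of_orbitMap_eq Φ hx, stabilizer_eq_of_orbitMap_eq Φ hy, c.stabilizer_eq hc,
      c.stabilizer_eq hw]
    have hzw : c.zeros w = c.zeros z := Set.eq_of_subset_of_ncard_le hwz (by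
      rw [hΦ.ncard_zeros c hc, hΦ.ncard_zeros c hw, facetCount_eq_one_iff.2 ⟨F, hp⟩,
        facetCount_eq_one_iff.2 ⟨F, hwF⟩])
    rw [hzw]
  · intro p₁ p₂ p₃ _ _ _ h12 h23 x y hx hy
    obtain ⟨z, hz⟩ := orbitMap_surjective Φ p₂
    exact (h12 x z hx hz).trans (h23 z y hz hy)

/-- Every vanishing coordinate at `x` belongs to a facet containing the orbit of `x`. -/
theorem exists_facet_of_mem_zeros {m : ℕ} (hP : IsSimplePolytope m P)
    (hΦ : PreservesCorners Φ) (c : KStandardChart n k M) {x : M} (hx : x ∈ c.toHomeo.source)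
    {i : Fin n} (hi : i ∈ c.zeros x) :
    ∃ F : Facets P, (orbitMap Φ x : E) ∈ F.1 ∧ ∃ y : M, orbitMap Φ y ∈ openFacet F ∧
      MulAction.stabilizer (Torus (n + k)) y = circleSubgroup (c.basis (Fin.castAdd k i)) := by
  have := hP.finite_facets
  have h1 : ∃ᶠ y in 𝓝 x, ∃ F : Facets P, orbitMap Φ y ∈ openFacet F ∧
      MulAction.stabilizer (Torus (n + k)) y = circleSubgroup (c.basis (Fin.castAdd k i)) := by
    refine (c.exists_perturbation hx (Set.singleton_subset_iff.2 hi)).mono ?_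
    rintro y ⟨hy, hyi⟩
    have h2 : facetCount P (orbitMap Φ y : E) = 1 := by
      rw [← hΦ.ncard_zeros c hy, hyi, Set.ncard_singleton]
    obtain ⟨F, hF⟩ := facetCount_eq_one_iff.1 h2
    refine ⟨F, hF, ?_⟩
    rw [c.stabilizer_eq hy, hyi]
    exact iSup_unique (f := fun j : ({i} : Set (Fin n)) =>
      circleSubgroup (c.basis (Fin.castAdd k (j : Fin n))))
  -- As there are finitely many facets, one `F` occurs arbitrarily close to `x`; being closed, it
  -- contains the image of `x`.
  obtain ⟨F, hF⟩ := frequently_exists.1 h1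
  refine ⟨F, ?_, hF.exists⟩
  have hcl : IsClosed {y : M | (orbitMap Φ y : E) ∈ F.1} :=
    (F.2.isExposed.isClosed hP.isCompact.isClosed).preimage
      (continuous_subtype_val.comp (continuous_orbitMap Φ))
  exact hcl.mem_of_frequently_of_tendsto (hF.mono fun y hy => (hy.1 F).2 rfl) tendsto_id

/-- The vanishing coordinates at `x` correspond to the facets containing the orbit of `x`. -/
theorem exists_equiv_facets_stabilizer (hM : IsLocallyKStandard n k M) {m : ℕ}
    (hP : IsSimplePolytope m P)
    (hΦ : PreservesCorners Φ) (c : KStandardChart n k M) {x : M} (hx : x ∈ c.toHomeo.source) :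
    ∃ e : c.zeros x ≃ {F : Facets P // (orbitMap Φ x : E) ∈ F.1}, ∀ i, ∃ y : M,
      orbitMap Φ y ∈ openFacet (e i).1 ∧
      MulAction.stabilizer (Torus (n + k)) y = circleSubgroup (c.basis (Fin.castAdd k i)) := by
  have := hP.finite_facets
  choose G hxG y hyG hy using fun i : c.zeros x => exists_facet_of_mem_zeros hP hΦ c hx i.2
  have hinj : Function.Injective G := by
    intro i j hij
    have h1 : circleSubgroup (c.basis (Fin.castAdd k i)) =
        circleSubgroup (c.basis (Fin.castAdd k j)) := by
      rw [← hy, ← hy]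
      exact stabilizer_eq_of_mem_openFacet hM hP.convex hΦ (hyG i) (hij ▸ hyG j)
    by_contra hne
    have hne' : Fin.castAdd k (j : Fin n) ≠ Fin.castAdd k i := fun h =>
      hne (Subtype.ext (Fin.castAdd_injective n k h.symm))
    have h2 : c.basis.repr (c.basis (Fin.castAdd k i)) (Fin.castAdd k i) = 1 := by simp
    rcases eq_or_eq_neg_of_circleSubgroup_le (isPrimitiveVector_basis _ _)
      (isPrimitiveVector_basis _ _) h1.le with h | h
    · rw [h] at h2
      simp [hne'] at h2
    · rw [h] at h2
      simp [hne'] at h2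
  have hbij : Function.Bijective fun i =>
      (⟨G i, hxG i⟩ : {F : Facets P // (orbitMap Φ x : E) ∈ F.1}) :=
    (Nat.bijective_iff_injective_and_card _).2
      ⟨fun i j h => hinj (congrArg Subtype.val h), hΦ.ncard_zeros c hx⟩
  exact ⟨Equiv.ofBijective _ hbij, fun i => ⟨y i, hyG i, hy i⟩⟩

/-- The subgroups fixing the preimages of the facets at the orbit of `x` are the coordinate circles
of the vanishing coordinates at `x`. -/
theorem exists_equiv_facets (hM : IsLocallyKStandard n k M) {m : ℕ} (hP : IsSimplePolytope m P)
    (hΦ : PreservesCorners Φ) (c : KStandardChart n k M) {x : M} (hx : x ∈ c.toHomeo.source) :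
    ∃ e : c.zeros x ≃ {F : Facets P // (orbitMap Φ x : E) ∈ F.1}, ∀ i,
      fixingSubgroup (Torus (n + k)) {y : M | (orbitMap Φ y : E) ∈ (e i).1.1} =
        circleSubgroup (c.basis (Fin.castAdd k i)) := by
  obtain ⟨e, he⟩ := exists_equiv_facets_stabilizer hM hP hΦ c hx
  refine ⟨e, fun i => ?_⟩
  obtain ⟨y, hye, hy⟩ := he i
  rw [← hy]
  apply le_antisymm
  · intro t ht
    exact (mem_fixingSubgroup_iff _).1 ht y ((hye _).2 rfl)
  -- Conversely, at any `x'` over the facet a chart has a coordinate matched to this facet. Its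
  -- circle is the common stabilizer over the open facet, and it fixes `x'`.
  · intro t ht
    refine (mem_fixingSubgroup_iff _).2 fun x' hx' => ?_
    obtain ⟨c', hc'⟩ := hM.exists_chart x'
    obtain ⟨e', he'⟩ := exists_equiv_facets_stabilizer hM hP hΦ c' hc'
    obtain ⟨i', hi'⟩ := e'.surjective ⟨(e i).1, hx'⟩
    obtain ⟨y', hye', hy'⟩ := he' i'
    rw [hi'] at hye'
    rw [stabilizer_eq_of_mem_openFacet hM hP.convex hΦ hye hye', hy'] at ht
    have h : t ∈ MulAction.stabilizer (Torus (n + k)) x' := by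
      rw [c'.stabilizer_eq hc']
      exact Subgroup.mem_iSup_of_mem i' ht
    exact h

end OrbitMap

/-! ### Characteristic functions and the global section -/

section Classification

open Topology Filter

variable {n k : ℕ} {M : Type*} [TopologicalSpace M]
  [ChartedSpace (EuclideanSpace ℝ (Fin (2 * n + k))) M] [MulAction (Torus (n + k)) M]
  [ContinuousSMul (Torus (n + k)) M]
  {E : Type*} [NormedAddCommGroup E] [NormedSpace ℝ E] {P : Set E} {m : ℕ}
  {Φ : OrbitSpace n k M ≃ₜ P}

theorem exists_isAxiomaticCharacteristic (hM : IsLocallyKStandard n k M)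
    (hP : IsSimplePolytope m P) (hΦ : PreservesCorners Φ) :
    ∃ lam : Facets P → Fin (n + k) → ℤ, IsAxiomaticCharacteristic Φ lam := by
  have h : ∀ F : Facets P, ∃ v : Fin (n + k) → ℤ, IsPrimitiveVector v ∧
      fixingSubgroup (Torus (n + k)) {x : M | (orbitMap Φ x : E) ∈ F.1} = circleSubgroup v := by
    intro F
    obtain ⟨p, hp⟩ := F.2.nonempty
    obtain ⟨x, hx⟩ := orbitMap_surjective Φ ⟨p, F.2.isExposed.subset hp⟩
    obtain ⟨c, hc⟩ := hM.exists_chart x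
    obtain ⟨e, he⟩ := exists_equiv_facets hM hP hΦ c hc
    obtain ⟨i, hi⟩ := e.surjective ⟨F, by rwa [hx]⟩
    have := he i
    rw [hi] at this
    exact ⟨_, isPrimitiveVector_basis _ _, this⟩
  exact ⟨fun F => (h F).choose, fun F => (h F).choose_spec⟩

/-- Permuting and changing the signs of the first elements of a basis. -/
theorem exists_basis_of_eq_or_eq_neg (b : Module.Basis (Fin (n + k)) ℤ (Fin (n + k) → ℤ))
    {σ : Fin n → Fin n} (hσ : Function.Injective σ) {v : Fin n → Fin (n + k) → ℤ}
    (hv : ∀ i, v i = b (Fin.castAdd k (σ i)) ∨ v i = -b (Fin.castAdd k (σ i))) :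
    ∃ b' : Module.Basis (Fin (n + k)) ℤ (Fin (n + k) → ℤ), ∀ i, b' (Fin.castAdd k i) = v i := by
  have hu : ∀ i, ∃ u : ℤˣ, v i = u • b (Fin.castAdd k (σ i)) := fun i => by
    rcases hv i with h | h
    · exact ⟨1, by rw [h, one_smul]⟩
    · exact ⟨-1, by rw [h, Units.neg_smul, one_smul]⟩
  choose u hu using hu
  let π : Equiv.Perm (Fin (n + k)) := finSumFinEquiv.symm.trans
    ((Equiv.sumCongr (Equiv.ofBijective σ (Finite.injective_iff_bijective.1 hσ))
      (Equiv.refl (Fin k))).trans finSumFinEquiv)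
  refine ⟨(b.reindex π.symm).unitsSMul (Fin.append u fun _ => 1), fun i => ?_⟩
  rw [Module.Basis.unitsSMul_apply, Module.Basis.reindex_apply, Fin.append_left, hu i]
  simp [π]

theorem IsAxiomaticCharacteristic.circleSubgroup_eq {lam : Facets P → Fin (n + k) → ℤ}
    (hlam : IsAxiomaticCharacteristic Φ lam) (hM : IsLocallyKStandard n k M)
    (hP : IsSimplePolytope m P) (hΦ : PreservesCorners Φ) (c : KStandardChart n k M) {x : M}
    (hx : x ∈ c.toHomeo.source) :
    ∃ e : c.zeros x ≃ {F : Facets P // (orbitMap Φ x : E) ∈ F.1}, ∀ i,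
      circleSubgroup (lam (e i).1) = circleSubgroup (c.basis (Fin.castAdd k i)) := by
  obtain ⟨e, he⟩ := exists_equiv_facets hM hP hΦ c hx
  exact ⟨e, fun i => by rw [← he, (hlam _).2]⟩

theorem IsAxiomaticCharacteristic.isHyperCharacteristic {lam : Facets P → Fin (n + k) → ℤ}
    (hlam : IsAxiomaticCharacteristic Φ lam) (hM : IsLocallyKStandard n k M)
    (hP : IsSimplePolytope m P) (hΦ : PreservesCorners Φ) : IsHyperCharacteristic n k P lam := by
  rintro f hf ⟨p, hp⟩
  rw [Set.mem_iInter] at hp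
  -- For `n = 0` the empty intersection is all of `E`, so `p` need not lie in `P`.
  rcases n.eq_zero_or_pos with hn | hn
  · exact ⟨Pi.basisFun ℤ _, fun i => absurd i.2 (by omega)⟩
  obtain ⟨x, hx⟩ := orbitMap_surjective Φ
    ⟨p, (f ⟨0, hn⟩).2.isExposed.subset (hp ⟨0, hn⟩)⟩
  have hpx : ∀ i, (orbitMap Φ x : E) ∈ (f i).1 := fun i => by rw [hx]; exact hp i
  obtain ⟨c, hc⟩ := hM.exists_chart x
  obtain ⟨e, he⟩ := hlam.circleSubgroup_eq hM hP hΦ c hc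
  let σ : Fin n → Fin n := fun i => (e.symm ⟨f i, hpx i⟩ : Fin n)
  have hσ : Function.Injective σ := fun i j hij =>
    hf (congrArg Subtype.val (e.symm.injective (Subtype.ext hij)))
  refine exists_basis_of_eq_or_eq_neg c.basis hσ fun i => ?_
  refine eq_or_eq_neg_of_circleSubgroup_le (hlam _).1 (isPrimitiveVector_basis _ _) ?_
  have := he (e.symm ⟨f i, hpx i⟩)
  rw [Equiv.apply_symm_apply] at this
  exact this.le

theorem IsAxiomaticCharacteristic.isotropySubgroup_eq {lam : Facets P → Fin (n + k) → ℤ}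
    (hlam : IsAxiomaticCharacteristic Φ lam) (hM : IsLocallyKStandard n k M)
    (hP : IsSimplePolytope m P) (hΦ : PreservesCorners Φ) (x : M) :
    isotropySubgroup P lam (orbitMap Φ x : E) = MulAction.stabilizer (Torus (n + k)) x := by
  obtain ⟨c, hc⟩ := hM.exists_chart x
  obtain ⟨e, he⟩ := hlam.circleSubgroup_eq hM hP hΦ c hc
  rw [c.stabilizer_eq hc, isotropySubgroup]
  exact (Equiv.iSup_congr e he).symm

/-- Stabilizers over points in no facet are trivial. -/
theorem stabilizer_eq_bot (hM : IsLocallyKStandard n k M) (hP : IsSimplePolytope m P)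
    (hΦ : PreservesCorners Φ) {x : M} (hx : ∀ F : Facets P, (orbitMap Φ x : E) ∉ F.1) :
    MulAction.stabilizer (Torus (n + k)) x = ⊥ := by
  have := hP.finite_facets
  obtain ⟨c, hc⟩ := hM.exists_chart x
  have h0 := hΦ.ncard_zeros c hc
  rw [facetCount_eq_zero_iff.2 hx, Set.ncard_eq_zero] at h0
  rw [c.stabilizer_eq hc, h0]
  exact iSup_of_empty _

/-- A perturbation makes all complex coordinates nonzero. The image of the resulting point is the
centre of the contraction of `P`. -/
theorem exists_orbitMap_notMem_facets (hM : IsLocallyKStandard n k M)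
    (hP : IsSimplePolytope m P) (hΦ : PreservesCorners Φ) :
    ∃ x : M, ∀ F : Facets P, (orbitMap Φ x : E) ∉ F.1 := by
  have := hP.finite_facets
  obtain ⟨p, hp⟩ := hP.nonempty
  obtain ⟨x, -⟩ := orbitMap_surjective Φ ⟨p, hp⟩
  obtain ⟨c, hc⟩ := hM.exists_chart x
  obtain ⟨y, hy, hy0⟩ := (c.exists_perturbation hc (Set.empty_subset _)).exists
  refine ⟨y, facetCount_eq_zero_iff.1 ?_⟩
  rw [← hΦ.ncard_zeros c hy, hy0, Set.ncard_empty]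

/-- The orbit map of a locally `k`-standard manifold over a simple polytope has a global section. -/
theorem exists_section_orbitMap [T2Space M] (hM : IsLocallyKStandard n k M)
    (hP : IsSimplePolytope m P) (hΦ : PreservesCorners Φ) :
    ∃ s : P → M, Continuous s ∧ ∀ p, orbitMap Φ (s p) = p := by
  have : CompactSpace P := isCompact_iff_compactSpace.1 hP.isCompact
  obtain ⟨x₀, hx₀⟩ := exists_orbitMap_notMem_facets hM hP hΦ
  -- Homotopies are parametrized by all of `ℝ`; clamping the time keeps the track inside `P`.
  let clamp : ℝ → ℝ := fun s => max 0 (min 1 s)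
  have hclamp : ∀ s, clamp s ∈ Set.Icc (0 : ℝ) 1 := fun s =>
    ⟨le_max_left _ _, max_le zero_le_one (min_le_left _ _)⟩
  let H : P → ℝ → P := fun p s => ⟨AffineMap.lineMap (orbitMap Φ x₀ : E) (p : E) (clamp s),
    hP.convex.lineMap_mem (orbitMap Φ x₀).2 p.2 (hclamp s)⟩
  have hH : Continuous fun p : P × ℝ => H p.1 p.2 := by
    refine Continuous.subtype_mk ?_ _
    simp only [AffineMap.lineMap_apply_module, clamp]
    fun_prop
  have hH0 : ∀ p, H p 0 = orbitMap Φ x₀ := fun p => Subtype.ext (by simp [H, clamp])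
  have hH1 : ∀ p, H p 1 = p := fun p => Subtype.ext (by simp [H, clamp])
  have hsec : ∀ p : P, ∃ U : Set P, IsOpen U ∧ p ∈ U ∧
      ∃ s : P → M, ContinuousOn s U ∧ ∀ p ∈ U, orbitMap Φ (s p) = p := by
    intro p
    obtain ⟨x, rfl⟩ := orbitMap_surjective Φ p
    obtain ⟨c, hc⟩ := hM.exists_chart x
    exact ⟨_, isOpenMap_orbitMap Φ _ c.toHomeo.open_source, ⟨x, hc, rfl⟩,
      c.exists_local_section Φ⟩
  have hstab : ∀ p s s', s ≤ s' → ∀ y y', orbitMap Φ y = H p s → orbitMap Φ y' = H p s' →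
      MulAction.stabilizer (Torus (n + k)) y ≤ MulAction.stabilizer (Torus (n + k)) y' := by
    intro p s s' hss' y y' hy hy'
    -- Before time `1` the stabilizer is trivial; from time `1` on the track is constant.
    rcases (hclamp s).2.lt_or_eq with h | h
    · rw [stabilizer_eq_bot hM hP hΦ (x := y) fun F => ?_]
      · exact bot_le
      · rw [hy]
        exact lineMap_notMem_facet (orbitMap Φ x₀).2 p.2 hx₀ (hclamp s).1 h F
    · have h' : clamp s' = 1 := le_antisymm (hclamp s').2
        (h.symm.le.trans (max_le_max_left _ (min_le_min_left _ hss')))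
      refine (stabilizer_eq_of_orbitMap_eq Φ ?_).le
      rw [hy, hy']
      simp only [H, h, h']
  obtain ⟨s, hs, hqs⟩ := exists_homotopy_lift (orbitMap_smul Φ)
    (fun x y => (orbitMap_eq_iff Φ x y).1) hsec hH hstab
    (continuous_const (y := x₀)) (fun p => (hH0 p).symm)
  exact ⟨s, hs, fun p => (hqs p).trans (hH1 p)⟩

theorem IsAxiomaticCharacteristic.exists_homeomorph [T2Space M] {lam : Facets P → Fin (n + k) → ℤ}
    (hlam : IsAxiomaticCharacteristic Φ lam) (hM : IsLocallyKStandard n k M)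
    (hP : IsSimplePolytope m P) (hΦ : PreservesCorners Φ) :
    ∃ h : M ≃ₜ QuotientConstruction P lam, ∀ (t : Torus (n + k)) (x : M),
      h (t • x) = t • h x := by
  have : CompactSpace P := isCompact_iff_compactSpace.1 hP.isCompact
  obtain ⟨s, hs, hqs⟩ := exists_section_orbitMap hM hP hΦ
  have hiso : ∀ p : P, isotropySubgroup P lam (p : E) =
      MulAction.stabilizer (Torus (n + k)) (s p) := fun p => by
    rw [← hlam.isotropySubgroup_eq hM hP hΦ, hqs]
  -- The defining relation is exactly the fibre relation of `(t, p) ↦ t • s p`, because the isotropy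
  -- group at `p` is the stabilizer of `s p`.
  have hrel : ∀ a b : Torus (n + k) × P,
      (quotientSetoid P lam) a b ↔ a.1 • s a.2 = b.1 • s b.2 := by
    rintro ⟨t, p⟩ ⟨r, p'⟩
    change p = p' ∧ t⁻¹ * r ∈ isotropySubgroup P lam (p : E) ↔ t • s p = r • s p'
    rw [hiso, MulAction.mem_stabilizer_iff, mul_smul, inv_smul_eq_iff]
    constructor
    · rintro ⟨rfl, h⟩
      exact h.symm
    · intro h
      have h' := congrArg (orbitMap Φ) h
      rw [orbitMap_smul, orbitMap_smul, hqs, hqs] at h'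
      subst h'
      exact ⟨rfl, h.symm⟩
  let g : QuotientConstruction P lam → M :=
    Quotient.lift (fun a : Torus (n + k) × P => a.1 • s a.2) fun a b h => (hrel a b).1 h
  have hg : Continuous g :=
    Continuous.quotient_lift (continuous_fst.smul (hs.comp continuous_snd)) _
  have hginj : Function.Injective g := by
    rintro ⟨a⟩ ⟨b⟩ h
    exact Quotient.sound ((hrel a b).2 h)
  have hgsurj : Function.Surjective g := by
    intro x
    obtain ⟨t, ht⟩ := (orbitMap_eq_iff Φ (s (orbitMap Φ x)) x).1 (hqs _)
    exact ⟨Quotient.mk _ (t, orbitMap Φ x), ht⟩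
  have hgsmul : ∀ (t : Torus (n + k)) y, g (t • y) = t • g y := by
    rintro t ⟨a⟩
    exact mul_smul t a.1 (s a.2)
  have : CompactSpace (QuotientConstruction P lam) :=
    inferInstanceAs (CompactSpace (Quotient (quotientSetoid P lam)))
  let e := (Equiv.ofBijective g ⟨hginj, hgsurj⟩)
  let h : QuotientConstruction P lam ≃ₜ M := Continuous.homeoOfEquivCompactToT2 (f := e) hg
  refine ⟨h.symm, fun t x => h.injective ?_⟩
  have hh : ∀ (t : Torus (n + k)) y, h (t • y) = t • h y := hgsmul
  rw [hh, h.apply_symm_apply, h.apply_symm_apply]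

end Classification

theorem corollary2p3 (n k : ℕ) (M : Type*) [TopologicalSpace M] [T2Space M]
    [SecondCountableTopology M] [ChartedSpace (EuclideanSpace ℝ (Fin (2 * n + k))) M]
    [IsManifold (𝓡 (2 * n + k)) ∞ M] [MulAction (Torus (n + k)) M]
    [ContinuousSMul (Torus (n + k)) M] (hM : IsLocallyKStandard n k M)
    (E : Type*) [NormedAddCommGroup E] [NormedSpace ℝ E] (P : Set E) (hP : IsSimplePolytope n P)
    (Φ : OrbitSpace n k M ≃ₜ P) (hΦ : PreservesCorners Φ) :
    (∃ lam : Facets P → Fin (n + k) → ℤ, IsAxiomaticCharacteristic Φ lam) ∧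
      ∀ lam : Facets P → Fin (n + k) → ℤ, IsAxiomaticCharacteristic Φ lam →
        IsHyperCharacteristic n k P lam ∧
          ∃ h : M ≃ₜ QuotientConstruction P lam, ∀ (t : Torus (n + k)) (x : M),
            h (t • x) = t • h x := by
  exact ⟨exists_isAxiomaticCharacteristic hM hP hΦ, fun lam hlam =>
    ⟨hlam.isHyperCharacteristic hM hP hΦ, hlam.exists_homeomorph hM hP hΦ⟩⟩
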